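/- Let $B\ge 1$ be an integer and let $N$ be a real number. A camel can carry at most $B$ bananas on its back and can have at most $2$ units of banana fuel in its stomach. Walking one mile uses one unit of fuel from its stomach. It eats bananas only whole, at its own position, and only when its stomach contains at most $1$ unit of fuel; each eaten banana adds $1$ unit. The camel may load and unload bananas wherever it is. It cannot walk with an empty stomach. At the start the camel is at the border of the desert (position $0$) with $\lfloor N\rfloor$ bananas next to it and $N-\lfloor N\rfloor$ units of fuel in its stomach (so, for integer $N$, with $N$ bananas and an empty stomach). An itinerary consists of finitely many actions: straight walks, loading and unloading, and eating. In the round trip variant, the itinerary must end at position $0$. Define $p_B:\mathbb{R}\to(0,\infty)$ by $$p_B(x)=\Big(1+\frac{2}{B}\Big)^{\lfloor x\rfloor}\Big(1+\frac{2}{B}\big(x-\lfloor x\rfloor\big)\Big),$$ which is a strictly increasing bijection. **Theorem.** If $N\ge B$, then in the round trip variant the camel cannot penetrate farther than $$p_B^{-1}\Big(\frac{N}{B}\Big)+\frac{B}{2}$$ miles into the desert; that is, every position $c$ that is reached in some itinerary ending at position $0$ satisfies $c\le p_B^{-1}(N/B)+B/2$. -/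

import Mathlib

namespace CamelBanana

/-- The function `p_B`: it equals `(1 + 2/B)^x` at integers `x` and is linear in between. -/
noncomputable def p (B : ℕ) (x : ℝ) : ℝ :=
  (1 + 2 / (B : ℝ)) ^ ⌊x⌋ * (1 + 2 / (B : ℝ) * (x - (⌊x⌋ : ℝ)))

/-- The inverse `p_B⁻¹`. For `B ≥ 1` the function `p_B` is a strictly increasing bijection from
`ℝ` onto the positive reals (`p_strictMono`, `p_pInv`), so this is its inverse there. -/
noncomputable def pInv (B : ℕ) (y : ℝ) : ℝ :=
  Function.invFun (p B) y

theorem p_strictMono (B : ℕ) (hB : 1 ≤ B) : StrictMono (p B) := by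
  intro x y hxy
  have hB0 : (0 : ℝ) < B := by exact_mod_cast hB
  have hd : (0 : ℝ) < 2 / (B : ℝ) := by positivity
  unfold p
  generalize 2 / (B : ℝ) = d at hd
  have ha : (0 : ℝ) < 1 + d := by linarith
  have hle : ⌊x⌋ ≤ ⌊y⌋ := Int.floor_le_floor hxy.le
  rcases hle.eq_or_lt with h | h
  · rw [h]
    have := zpow_pos ha ⌊y⌋
    gcongr
  · have h1 : (1 + d) ^ ⌊x⌋ * (1 + d * (x - (⌊x⌋ : ℝ))) < (1 + d) ^ (⌊x⌋ + 1) := by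
      rw [zpow_add_one₀ ha.ne']
      have := zpow_pos ha ⌊x⌋
      have h2 := Int.lt_floor_add_one x
      have h3 : d * (x - (⌊x⌋ : ℝ)) < d * 1 := by
        apply mul_lt_mul_of_pos_left _ hd
        linarith
      apply mul_lt_mul_of_pos_left _ this
      linarith
    have h4 : (1 + d) ^ (⌊x⌋ + 1) ≤ (1 + d) ^ ⌊y⌋ :=
      zpow_le_zpow_right₀ (by linarith) (by omega)
    have h5 : (1 + d) ^ ⌊y⌋ ≤ (1 + d) ^ ⌊y⌋ * (1 + d * (y - (⌊y⌋ : ℝ))) := by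
      have := zpow_pos ha ⌊y⌋
      have h6 : 0 ≤ d * (y - (⌊y⌋ : ℝ)) := mul_nonneg hd.le (by linarith [Int.floor_le y])
      nlinarith
    linarith

theorem p_pInv (B : ℕ) (hB : 1 ≤ B) {y : ℝ} (hy : 0 < y) : p B (pInv B y) = y := by
  apply Function.invFun_eq
  have hB0 : (0 : ℝ) < B := by exact_mod_cast hB
  have hd : (0 : ℝ) < 2 / (B : ℝ) := by positivity
  unfold p
  generalize 2 / (B : ℝ) = d at hd
  have ha : (0 : ℝ) < 1 + d := by linarith
  obtain ⟨k, hk1, hk2⟩ := exists_mem_Ico_zpow hy (show 1 < 1 + d by linarith)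
  have hk := zpow_pos ha k
  rw [zpow_add_one₀ ha.ne'] at hk2
  have hf : ⌊(k : ℝ) + (y / (1 + d) ^ k - 1) / d⌋ = k := by
    rw [Int.floor_eq_iff]
    constructor
    · have : 1 ≤ y / (1 + d) ^ k := by rwa [one_le_div hk]
      have : 0 ≤ (y / (1 + d) ^ k - 1) / d := div_nonneg (by linarith) hd.le
      linarith
    · have h1 : y / (1 + d) ^ k < 1 + d := by rw [div_lt_iff₀ hk]; linarith
      have : (y / (1 + d) ^ k - 1) / d < 1 := by rw [div_lt_one hd]; linarith
      linarith
  refine ⟨(k : ℝ) + (y / (1 + d) ^ k - 1) / d, ?_⟩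
  rw [hf]
  field_simp
  ring

theorem pInv_p (B : ℕ) (hB : 1 ≤ B) (x : ℝ) : pInv B (p B x) = x :=
  Function.leftInverse_invFun (p_strictMono B hB).injective x

/-- A situation with a stock of `n` (distinguishable) bananas. Positions are distances, in miles,
from the border of the desert, which is at `0`. The values of `banana` at bananas that have been
eaten play no role. -/
@[ext]
structure State (n : ℕ) where
  /-- position of the camel -/
  camel : ℝ
  /-- banana fuel in the stomach of the camel -/
  stomach : ℝ
  /-- bananas that have not yet been eaten -/
  remaining : Finset (Fin n)
  /-- positions of the bananas -/
  banana : Fin n → ℝ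

/-- The elementary actions of a camel that can carry `B` bananas on its back. Bananas can be
loaded and unloaded freely wherever the camel is, so it only matters which bananas are
on its back during each straight walk. -/
inductive Step (B : ℕ) {n : ℕ} : State n → State n → Prop
  /-- Walk straight to `y`, carrying a set `S` of at most `B` remaining bananas from the present
  position; this takes one unit of banana fuel per mile, from the stomach. -/
  | walk (s : State n) (y : ℝ) (S : Finset (Fin n))
      (hS : S ⊆ s.remaining) (hpos : ∀ i ∈ S, s.banana i = s.camel) (hcard : S.card ≤ B)
      (hfuel : |y - s.camel| ≤ s.stomach) :
      Step B s
        { camel := y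
          stomach := s.stomach - |y - s.camel|
          remaining := s.remaining
          banana := fun i => if i ∈ S then y else s.banana i }
  /-- Eat a (whole) remaining banana at the present position, which is possible if there is at
  most one unit of banana fuel in the stomach. -/
  | eat (s : State n) (i : Fin n)
      (hi : i ∈ s.remaining) (hpos : s.banana i = s.camel) (hstomach : s.stomach ≤ 1) :
      Step B s
        { camel := s.camel
          stomach := s.stomach + 1
          remaining := s.remaining.erase i
          banana := s.banana }

/-- The start with `N` bananas: the camel is at the border with `⌊N⌋` bananas next to it
and `N - ⌊N⌋` units of banana fuel in its stomach. -/
noncomputable def start (N : ℝ) : State ⌊N⌋₊ where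
  camel := 0
  stomach := N - (⌊N⌋₊ : ℝ)
  remaining := Finset.univ
  banana := fun _ => 0

/-- In the round trip variant with `N` bananas, a camel that can carry `B` bananas on its back can
penetrate to position `c`: some itinerary reaches position `c` and ends at the border. -/
def CanPenetrateRoundTrip (B : ℕ) (N c : ℝ) : Prop :=
  ∃ s e : State ⌊N⌋₊,
    Relation.ReflTransGen (Step B) (start N) s ∧ s.camel = c ∧
    Relation.ReflTransGen (Step B) s e ∧ e.camel = 0

end CamelBanana

namespace CamelBanana

/-! ### Convexity and growth of `p`. -/

section IncrementBound

variable {B : ℕ}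

/-! The proof is a potential argument. For a target `c + B/2` with `c ≥ 0`, put `K = ⌊c⌋`. A banana
at `x` is worth `p B (min x K)`, and the camel has a value depending on its position and fuel, tuned
so that no action increases the total (`Step.value_le`). This rests on the convexity of `p` and on
the relation `B/2 * (p (x+1) - p x) = p x`. The initial total is `N`, and at the border the camel is
worth its fuel, so the final total is nonnegative. Beyond `K` the camel's value contains `ε * (x -
K) * p K`: with `ε = 1` distance is credited on the way out, with `ε = -1` it is debited on the way
back. Switching the sign at `c + B/2` lowers the total by `2 * (c + B/2 - K) * p K = B * p c`, hence
`B * p c ≤ N`. -/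

theorem p_pos (hB : 1 ≤ B) (x : ℝ) : 0 < p B x := by
  have hB0 : (0 : ℝ) < B := by exact_mod_cast hB
  have h1 : (0 : ℝ) ≤ x - ⌊x⌋ := by linarith [Int.floor_le x]
  unfold p
  positivity

theorem p_add_one (hB : 1 ≤ B) (x : ℝ) : p B (x + 1) = (1 + 2 / (B : ℝ)) * p B x := by
  have hB0 : (0 : ℝ) < B := by exact_mod_cast hB
  have ha : (1 + 2 / (B : ℝ)) ≠ 0 := by positivity
  unfold p
  rw [Int.floor_add_one, zpow_add_one₀ ha]
  push_cast
  ring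

/-- This difference equation converts the price of one banana into an increment of `p`, making
eating comparable with walking. -/
theorem half_mul_p_add_one (hB : 1 ≤ B) (x : ℝ) :
    (B : ℝ) / 2 * p B (x + 1) = (B : ℝ) / 2 * p B x + p B x := by
  have hB0 : (0 : ℝ) < B := by exact_mod_cast hB
  rw [p_add_one hB]
  field_simp

theorem p_intCast (n : ℤ) : p B n = (1 + 2 / (B : ℝ)) ^ n := by
  simp [p]

/-- `p B` is affine between consecutive integers. -/
theorem p_int_add (hB : 1 ≤ B) (n : ℤ) {t : ℝ} (h0 : 0 ≤ t) (h1 : t ≤ 1) :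
    p B (n + t) = p B n * (1 + 2 / (B : ℝ) * t) := by
  rcases h1.eq_or_lt with rfl | h1
  · rw [p_add_one hB]
    ring
  · have hf : ⌊(n : ℝ) + t⌋ = n := by
      rw [Int.floor_eq_iff]
      constructor <;> linarith
    rw [p_intCast]
    unfold p
    rw [hf, add_sub_cancel_left]

theorem half_mul_p_int_add (hB : 1 ≤ B) (n : ℤ) {t : ℝ} (h0 : 0 ≤ t) (h1 : t ≤ 1) :
    (B : ℝ) / 2 * p B (n + t) = (B : ℝ) / 2 * p B n + t * p B n := by
  have hB0 : (0 : ℝ) < B := by exact_mod_cast hB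
  rw [p_int_add hB n h0 h1]
  field_simp

theorem half_mul_p_of_mem_unit (hB : 1 ≤ B) {t : ℝ} (h0 : 0 ≤ t) (h1 : t ≤ 1) :
    (B : ℝ) / 2 * p B t = (B : ℝ) / 2 + t := by
  have h := half_mul_p_int_add hB 0 h0 h1
  rw [p_intCast] at h
  simpa using h

/-- The graph of `p B` lies above each of the lines through two consecutive vertices. -/
theorem line_le_p (hB : 1 ≤ B) (n : ℤ) (x : ℝ) :
    (1 + 2 / (B : ℝ)) ^ n * (1 + 2 / (B : ℝ) * (x - n)) ≤ p B x := by
  have hB0 : (0 : ℝ) < B := by exact_mod_cast hB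
  have hd : (0 : ℝ) < 2 / (B : ℝ) := by positivity
  unfold p
  generalize 2 / (B : ℝ) = d at hd
  have ha : (0 : ℝ) < 1 + d := by linarith
  -- Consecutive lines cross at `m + 1`, so at `x` their heights rise with the index up to `⌊x⌋` and
  -- fall afterwards.
  have step : ∀ m : ℤ, (1 + d) ^ (m + 1) * (1 + d * (x - ((m + 1 : ℤ) : ℝ))) =
      (1 + d) ^ m * (1 + d * (x - m)) + (1 + d) ^ m * d ^ 2 * (x - (m + 1)) := by
    intro m
    rw [zpow_add_one₀ ha.ne']
    push_cast
    ring
  rcases le_total n ⌊x⌋ with h | h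
  · suffices H : ∀ m : ℤ, n ≤ m → m ≤ ⌊x⌋ → (1 + d) ^ n * (1 + d * (x - n)) ≤
        (1 + d) ^ m * (1 + d * (x - m)) from H _ h le_rfl
    intro m hm
    induction m, hm using Int.leInduction with
    | base => intro; exact le_rfl
    | succ m hm ih =>
      intro hmx
      have h1 : ((m + 1 : ℤ) : ℝ) ≤ x := Int.le_floor.1 hmx
      push_cast at h1
      have h2 : 0 ≤ (1 + d) ^ m * d ^ 2 * (x - (m + 1)) :=
        mul_nonneg (by positivity) (by linarith)
      rw [step]
      linarith [ih (by omega)]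
  · suffices H : ∀ m : ℤ, ⌊x⌋ ≤ m → (1 + d) ^ m * (1 + d * (x - m)) ≤
        (1 + d) ^ ⌊x⌋ * (1 + d * (x - ⌊x⌋)) from H _ h
    intro m hm
    induction m, hm using Int.leInduction with
    | base => exact le_rfl
    | succ m hm ih =>
      have h1 : (⌊x⌋ : ℝ) ≤ m := by exact_mod_cast hm
      have h2 : 0 ≤ (1 + d) ^ m * d ^ 2 * (m + 1 - x) :=
        mul_nonneg (by positivity) (by linarith [Int.lt_floor_add_one x])
      rw [step]
      nlinarith

theorem p_convexOn (hB : 1 ≤ B) : ConvexOn ℝ Set.univ (p B) := by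
  refine ⟨convex_univ, fun x _ y _ a b ha hb hab => ?_⟩
  simp only [smul_eq_mul]
  have hx := mul_le_mul_of_nonneg_left (line_le_p hB ⌊a * x + b * y⌋ x) ha
  have hy := mul_le_mul_of_nonneg_left (line_le_p hB ⌊a * x + b * y⌋ y) hb
  -- At the convex combination itself the chosen line coincides with `p`, by definition.
  refine le_trans (le_of_eq ?_) (add_le_add hx hy)
  rw [p]
  generalize (⌊a * x + b * y⌋ : ℤ) = n
  obtain rfl : b = 1 - a := by linarith
  ring

/-- Increments of `p B` over intervals of equal length increase from left to right. -/
theorem p_increment_mono (hB : 1 ≤ B) {a b d : ℝ} (hab : a ≤ b) (hd : 0 ≤ d) :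
    p B (a + d) - p B a ≤ p B (b + d) - p B b := by
  rcases (show 0 ≤ b + d - a by linarith).eq_or_lt with h | h
  · obtain rfl : b = a := by linarith
    exact le_rfl
  · have hs : (b - a) / (b + d - a) + d / (b + d - a) = 1 := by field_simp; ring
    have h0 : 0 ≤ (b - a) / (b + d - a) := div_nonneg (by linarith) h.le
    have h1 : 0 ≤ d / (b + d - a) := div_nonneg hd h.le
    have e1 := (p_convexOn hB).2 (Set.mem_univ a) (Set.mem_univ (b + d)) h0 h1 hs
    have e2 := (p_convexOn hB).2 (Set.mem_univ a) (Set.mem_univ (b + d)) h1 h0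
      (by rw [add_comm]; exact hs)
    simp only [smul_eq_mul] at e1 e2
    have r1 : (b - a) / (b + d - a) * a + d / (b + d - a) * (b + d) = a + d := by
      field_simp; ring
    have r2 : d / (b + d - a) * a + (b - a) / (b + d - a) * (b + d) = b := by
      field_simp; ring
    rw [r1] at e1
    rw [r2] at e2
    have e3 : (b - a) / (b + d - a) = 1 - d / (b + d - a) := by linarith
    rw [e3] at e1 e2
    nlinarith

end IncrementBound

/-! ### The value of bananas and camel, and its change under each action. -/

section Potential

/-- The value of a banana at position `x`; it is constant from `K` on. -/
noncomputable def bananaValue (B : ℕ) (K : ℤ) (x : ℝ) : ℝ :=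
  p B (min x K)

/-- The value of a camel at position `x` with `s` units of fuel in its stomach. The sign `ε` is `1`
as long as the farthest point still has to be visited, and `-1` afterwards. -/
noncomputable def camelValue (B : ℕ) (K : ℤ) (ε x s : ℝ) : ℝ :=
  if x ≤ K then
    if s ≤ 1 then (B : ℝ) / 2 * (p B 1 - p B (x + 1 - s))
    else (B : ℝ) / 2 * (p B (x + s - 1) - 2 * p B x + p B 1)
  else (B : ℝ) / 2 * (p B 1 - p B (K + 1)) + (s + ε * (x - K)) * p B K

variable {B : ℕ} {K : ℤ} {ε x y s : ℝ}

theorem bananaValue_pos (hB : 1 ≤ B) (K : ℤ) (x : ℝ) : 0 < bananaValue B K x :=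
  p_pos hB _

theorem bananaValue_mono (hB : 1 ≤ B) (K : ℤ) : Monotone (bananaValue B K) :=
  fun _ _ h => (p_strictMono B hB).monotone (min_le_min_right _ h)

theorem bananaValue_of_le (h : x ≤ K) : bananaValue B K x = p B x := by
  rw [bananaValue, min_eq_left h]

theorem bananaValue_of_ge (h : (K : ℝ) ≤ x) : bananaValue B K x = p B K := by
  rw [bananaValue, min_eq_right h]

theorem camelValue_of_le_one (hx : x ≤ K) (hs : s ≤ 1) :
    camelValue B K ε x s = (B : ℝ) / 2 * (p B 1 - p B (x + 1 - s)) := by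
  rw [camelValue, if_pos hx, if_pos hs]

theorem camelValue_of_one_le (hx : x ≤ K) (hs : 1 ≤ s) :
    camelValue B K ε x s = (B : ℝ) / 2 * (p B (x + s - 1) - 2 * p B x + p B 1) := by
  rcases hs.eq_or_lt with rfl | hs
  · rw [camelValue_of_le_one hx le_rfl, add_sub_cancel_right]
    ring
  · rw [camelValue, if_pos hx, if_neg hs.not_ge]

/-- The formulas agree at `x = K` because `K` is an integer, so `p` is affine on `[K, K + 1]`. Walks
across `K` can therefore be split there. -/
theorem camelValue_of_ge (hB : 1 ≤ B) (hx : (K : ℝ) ≤ x) (h0 : 0 ≤ s) (h2 : s ≤ 2) :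
    camelValue B K ε x s =
      (B : ℝ) / 2 * (p B 1 - p B (K + 1)) + (s + ε * (x - K)) * p B K := by
  rcases hx.eq_or_lt with rfl | hx
  · have e1 := half_mul_p_add_one hB (K : ℝ)
    rcases le_total s 1 with hs | hs
    · have e2 := half_mul_p_int_add hB K (t := 1 - s) (by linarith) (by linarith)
      rw [camelValue_of_le_one le_rfl hs, add_sub_assoc]
      linear_combination e1 - e2
    · have e2 := half_mul_p_int_add hB K (t := s - 1) (by linarith) (by linarith)
      rw [camelValue_of_one_le le_rfl hs, add_sub_assoc]
      linear_combination e1 + e2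
  · rw [camelValue, if_neg hx.not_ge]

theorem camelValue_zero (hB : 1 ≤ B) (hK : 0 ≤ K) (h0 : 0 ≤ s) (h2 : s ≤ 2) :
    camelValue B K ε 0 s = s := by
  have hK' : (0 : ℝ) ≤ K := by exact_mod_cast hK
  have e1 := half_mul_p_of_mem_unit hB (t := 1) zero_le_one le_rfl
  have e0 := half_mul_p_of_mem_unit hB (t := 0) le_rfl zero_le_one
  rcases le_total s 1 with hs | hs
  · have e2 := half_mul_p_of_mem_unit hB (t := 1 - s) (by linarith) (by linarith)
    rw [camelValue_of_le_one hK' hs, zero_add]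
    linear_combination e1 - e2
  · have e2 := half_mul_p_of_mem_unit hB (t := s - 1) (by linarith) (by linarith)
    rw [camelValue_of_one_le hK' hs, zero_add]
    linear_combination e1 + e2 - 2 * e0

theorem camelValue_eat (hB : 1 ≤ B) (h0 : 0 ≤ s) (h1 : s ≤ 1) :
    camelValue B K ε x (s + 1) ≤ camelValue B K ε x s + bananaValue B K x := by
  rcases le_total x K with hx | hx
  · have hB0 : (0 : ℝ) ≤ (B : ℝ) / 2 := by positivity
    have e1 := half_mul_p_add_one hB x
    -- After replacing the banana's price by an increment over `[x, x + 1]`, only this comparison of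
    -- its first and last parts of length `s` remains.
    have e2 := p_increment_mono hB (a := x) (b := x + 1 - s) (d := s) (by linarith) h0
    rw [camelValue_of_le_one hx h1, camelValue_of_one_le hx (by linarith), bananaValue_of_le hx]
    rw [show x + 1 - s + s = x + 1 by ring] at e2
    rw [show x + (s + 1) - 1 = x + s by ring]
    nlinarith
  · rw [camelValue_of_ge hB hx h0 (by linarith), camelValue_of_ge hB hx (by linarith) (by linarith),
      bananaValue_of_ge hx]
    linarith

theorem camelValue_forward_of_le (hB : 1 ≤ B) (hxy : x ≤ y) (hy : y ≤ K) :
    camelValue B K ε y (s - (y - x)) + B * (bananaValue B K y - bananaValue B K x) ≤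
      camelValue B K ε x s := by
  have hB0 : (0 : ℝ) ≤ (B : ℝ) / 2 := by positivity
  have hx : x ≤ K := hxy.trans hy
  rw [bananaValue_of_le hx, bananaValue_of_le hy]
  have low : ∀ {x s : ℝ}, x ≤ y → s ≤ 1 →
      camelValue B K ε y (s - (y - x)) + B * (p B y - p B x) ≤ camelValue B K ε x s := by
    intro x s hxy hs
    rw [camelValue_of_le_one (hxy.trans hy) hs, camelValue_of_le_one hy (by linarith)]
    -- The argument `x + 1 - s` grows by `2 * (y - x)`: position and fuel loss each contribute once.
    -- Both resulting increments dominate the one over `[x, y]`.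
    have e1 := p_increment_mono hB (a := x) (b := x + 1 - s) (d := y - x)
      (by linarith) (by linarith)
    have e2 := p_increment_mono hB (a := x) (b := x + 1 - s + (y - x)) (d := y - x)
      (by linarith) (by linarith)
    rw [show x + (y - x) = y by ring] at e1 e2
    rw [show x + 1 - s + (y - x) + (y - x) = y + 1 - (s - (y - x)) by ring] at e2
    nlinarith
  -- Above one unit of fuel, a forward walk with full load preserves the value exactly.
  have high : ∀ {y : ℝ}, y ≤ K → x ≤ y → 1 ≤ s - (y - x) →
      camelValue B K ε y (s - (y - x)) + B * (p B y - p B x) ≤ camelValue B K ε x s := by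
    intro y hy hxy hs
    rw [camelValue_of_one_le hx (by linarith), camelValue_of_one_le hy hs,
      show y + (s - (y - x)) - 1 = x + s - 1 by ring]
    apply le_of_eq
    ring
  rcases le_total s 1 with hs | hs
  · exact low hxy hs
  rcases le_total 1 (s - (y - x)) with hs' | hs'
  · exact high hy hxy hs'
  · have h1 := high (y := x + (s - 1)) (by linarith) (by linarith) (by linarith)
    have h2 := low (x := x + (s - 1)) (s := 1) (by linarith) le_rfl
    rw [show s - (x + (s - 1) - x) = 1 by ring] at h1
    rw [show 1 - (y - (x + (s - 1))) = s - (y - x) by ring] at h2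
    linarith

/-- A forward walk that carries `B` bananas does not increase the total value. -/
theorem camelValue_forward (hB : 1 ≤ B) (hε : ε ≤ 1) (hxy : x ≤ y) (hs : y - x ≤ s)
    (h2 : s ≤ 2) :
    camelValue B K ε y (s - (y - x)) + B * (bananaValue B K y - bananaValue B K x) ≤
      camelValue B K ε x s := by
  have far : ∀ {x s : ℝ}, (K : ℝ) ≤ x → x ≤ y → y - x ≤ s → s ≤ 2 →
      camelValue B K ε y (s - (y - x)) + B * (bananaValue B K y - bananaValue B K x) ≤
      camelValue B K ε x s := by
    intro x s hx hxy hs h2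
    rw [bananaValue_of_ge hx, bananaValue_of_ge (hx.trans hxy),
      camelValue_of_ge hB hx (by linarith) h2,
      camelValue_of_ge hB (hx.trans hxy) (by linarith) (by linarith)]
    have := mul_nonneg (mul_nonneg (sub_nonneg.2 hε) (sub_nonneg.2 hxy)) (p_pos hB (K : ℝ)).le
    nlinarith
  rcases le_total y K with hy | hy
  · exact camelValue_forward_of_le hB hxy hy
  rcases le_total (K : ℝ) x with hx | hx
  · exact far hx hxy hs h2
  · have h1 := camelValue_forward_of_le (ε := ε) (s := s) hB hx le_rfl
    have h3 := far (x := K) (s := s - (K - x)) le_rfl hy (by linarith) (by linarith)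
    rw [show s - (K - x) - (y - K) = s - (y - x) by ring] at h3
    linarith

theorem camelValue_backward_of_le (hB : 1 ≤ B) (hyx : y ≤ x) (hx : x ≤ K) :
    camelValue B K ε y (s - (x - y)) ≤ camelValue B K ε x s := by
  have hB0 : (0 : ℝ) ≤ (B : ℝ) / 2 := by positivity
  have hy : y ≤ K := hyx.trans hx
  -- Here walking back keeps `x - s`, and hence the value, unchanged.
  have low : ∀ {x s : ℝ}, x ≤ K → y ≤ x → s ≤ 1 →
      camelValue B K ε y (s - (x - y)) ≤ camelValue B K ε x s := by
    intro x s hx hyx hs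
    rw [camelValue_of_le_one hx hs, camelValue_of_le_one hy (by linarith),
      show y + 1 - (s - (x - y)) = x + 1 - s by ring]
  have high : ∀ {y : ℝ}, y ≤ K → y ≤ x → 1 ≤ s - (x - y) →
      camelValue B K ε y (s - (x - y)) ≤ camelValue B K ε x s := by
    intro y hy hyx hs
    rw [camelValue_of_one_le hx (by linarith), camelValue_of_one_le hy hs]
    have e1 := p_increment_mono hB (a := y) (b := y + (s - (x - y)) - 1) (d := x - y)
      (by linarith) (by linarith)
    have e2 := p_increment_mono hB (a := y) (b := y + (s - (x - y)) - 1 + (x - y)) (d := x - y)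
      (by linarith) (by linarith)
    rw [show y + (x - y) = x by ring] at e1 e2
    rw [show y + (s - (x - y)) - 1 + (x - y) + (x - y) = x + s - 1 by ring] at e2
    exact mul_le_mul_of_nonneg_left (by linarith) hB0
  rcases le_total s 1 with hs | hs
  · exact low hx hyx hs
  rcases le_total 1 (s - (x - y)) with hs' | hs'
  · exact high hy hyx hs'
  · have h1 := high (y := x - (s - 1)) (by linarith) (by linarith) (by linarith)
    have h2 := low (x := x - (s - 1)) (s := 1) (by linarith) (by linarith) le_rfl
    rw [show s - (x - (x - (s - 1))) = 1 by ring] at h1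
    rw [show 1 - (x - (s - 1) - y) = s - (x - y) by ring] at h2
    linarith

/-- A backward walk does not increase the value of the camel. -/
theorem camelValue_backward (hB : 1 ≤ B) (hε : -1 ≤ ε) (hyx : y ≤ x) (hs : x - y ≤ s)
    (h2 : s ≤ 2) :
    camelValue B K ε y (s - (x - y)) ≤ camelValue B K ε x s := by
  have far : ∀ {y : ℝ}, (K : ℝ) ≤ y → y ≤ x → x - y ≤ s →
      camelValue B K ε y (s - (x - y)) ≤ camelValue B K ε x s := by
    intro y hy hyx hs
    rw [camelValue_of_ge hB (hy.trans hyx) (by linarith) h2,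
      camelValue_of_ge hB hy (by linarith) (by linarith)]
    have := mul_nonneg (mul_nonneg (show 0 ≤ 1 + ε by linarith) (sub_nonneg.2 hyx))
      (p_pos hB (K : ℝ)).le
    nlinarith
  rcases le_total x K with hx | hx
  · exact camelValue_backward_of_le hB hyx hx
  rcases le_total (K : ℝ) y with hy | hy
  · exact far hy hyx hs
  · have h1 := far (y := K) le_rfl hx (by linarith)
    have h3 := camelValue_backward_of_le (ε := ε) (s := s - (x - K)) hB hy le_rfl
    rw [show s - (x - K) - (K - y) = s - (x - y) by ring] at h3
    linarith

end Potential

/-! ### Monotonicity of the total value along itineraries. -/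

section Itinerary

variable {B n : ℕ} {K : ℤ} {ε : ℝ}

/-- The total value of the remaining bananas and the camel. -/
noncomputable def State.value (B : ℕ) (K : ℤ) (ε : ℝ) (s : State n) : ℝ :=
  ∑ i ∈ s.remaining, bananaValue B K (s.banana i) + camelValue B K ε s.camel s.stomach

theorem Step.stomach_mem {s e : State n} (h : Step B s e) (hs : s.stomach ∈ Set.Icc (0 : ℝ) 2) :
    e.stomach ∈ Set.Icc (0 : ℝ) 2 := by
  obtain ⟨h0, h2⟩ := hs
  cases h with
  | walk y S hS hpos hcard hfuel =>
    exact ⟨by simpa using hfuel, by simp only; linarith [abs_nonneg (y - s.camel)]⟩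
  | eat i hi hpos hstomach => exact ⟨by simp only; linarith, by simp only; linarith⟩

theorem Step.value_le (hB : 1 ≤ B) (hε : ε ∈ Set.Icc (-1 : ℝ) 1) {s e : State n}
    (h : Step B s e) (hs : s.stomach ∈ Set.Icc (0 : ℝ) 2) :
    e.value B K ε ≤ s.value B K ε := by
  obtain ⟨h0, h2⟩ := hs
  cases h with
  | walk y S hS hpos hcard hfuel =>
    have hsum : ∑ i ∈ s.remaining, bananaValue B K (if i ∈ S then y else s.banana i) =
        ∑ i ∈ s.remaining, bananaValue B K (s.banana i) +
          S.card * (bananaValue B K y - bananaValue B K s.camel) := by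
      rw [← Finset.sum_sdiff hS, ← Finset.sum_sdiff hS (f := fun i => bananaValue B K (s.banana i)),
        Finset.sum_congr rfl (g := fun i => bananaValue B K (s.banana i))
          (fun i hi => by rw [if_neg (Finset.mem_sdiff.1 hi).2]),
        Finset.sum_congr (s₁ := S) rfl (g := fun _ => bananaValue B K y)
          (fun i hi => by rw [if_pos hi]),
        Finset.sum_congr (s₁ := S) rfl (f := fun i => bananaValue B K (s.banana i))
          (g := fun _ => bananaValue B K s.camel) (fun i hi => by rw [hpos i hi])]
      simp only [Finset.sum_const, nsmul_eq_mul]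
      ring
    simp only [State.value]
    rw [hsum]
    have hc : (S.card : ℝ) ≤ B := by exact_mod_cast hcard
    rcases le_total s.camel y with hy | hy
    · rw [abs_of_nonneg (sub_nonneg.2 hy)] at hfuel ⊢
      have h1 := camelValue_forward (K := K) hB hε.2 hy hfuel h2
      have h3 := mul_le_mul_of_nonneg_right hc (sub_nonneg.2 (bananaValue_mono hB K hy))
      linarith
    · rw [abs_sub_comm, abs_of_nonneg (sub_nonneg.2 hy)] at hfuel ⊢
      have h1 := camelValue_backward (K := K) hB hε.1 hy hfuel h2
      have h3 := mul_nonneg (Nat.cast_nonneg (α := ℝ) S.card)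
        (sub_nonneg.2 (bananaValue_mono hB K hy))
      linarith
  | eat i hi hpos hstomach =>
    simp only [State.value]
    have h1 := camelValue_eat (K := K) (ε := ε) (x := s.camel) hB h0 hstomach
    have h3 := Finset.add_sum_erase s.remaining (fun i => bananaValue B K (s.banana i)) hi
    simp only [hpos] at h3
    linarith

theorem value_le_of_reflTransGen (hB : 1 ≤ B) (hε : ε ∈ Set.Icc (-1 : ℝ) 1) {s e : State n}
    (h : Relation.ReflTransGen (Step B) s e) (hs : s.stomach ∈ Set.Icc (0 : ℝ) 2) :
    e.stomach ∈ Set.Icc (0 : ℝ) 2 ∧ e.value B K ε ≤ s.value B K ε := by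
  induction h with
  | refl => exact ⟨hs, le_rfl⟩
  | tail _ hstep ih => exact ⟨hstep.stomach_mem ih.1, (hstep.value_le hB hε ih.1).trans ih.2⟩

/-- A round trip that reaches position `c + B / 2` takes at least `B * p B c` bananas. -/
theorem mul_p_le_of_canPenetrateRoundTrip (hB : 1 ≤ B) {N c : ℝ} (hN : 0 ≤ N) (hc : 0 ≤ c)
    (h : CanPenetrateRoundTrip B N (c + (B : ℝ) / 2)) : (B : ℝ) * p B c ≤ N := by
  obtain ⟨s, e, hs, hsc, he, hec⟩ := h
  have hB0 : (0 : ℝ) < B := by exact_mod_cast hB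
  have hK : 0 ≤ ⌊c⌋ := Int.floor_nonneg.2 hc
  have hKc : (⌊c⌋ : ℝ) ≤ c := Int.floor_le c
  have h0 : 0 ≤ N - (⌊N⌋₊ : ℝ) := by linarith [Nat.floor_le hN]
  have h2 : N - (⌊N⌋₊ : ℝ) ≤ 2 := by linarith [Nat.lt_floor_add_one N]
  obtain ⟨hs2, hsv⟩ := value_le_of_reflTransGen (K := ⌊c⌋) (ε := 1) hB
    ⟨by norm_num, le_rfl⟩ hs ⟨h0, h2⟩
  obtain ⟨he2, hev⟩ := value_le_of_reflTransGen (K := ⌊c⌋) (ε := -1) hB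
    ⟨le_rfl, by norm_num⟩ he hs2
  have hstart : (start N).value B ⌊c⌋ 1 = N := by
    have h1 : bananaValue B ⌊c⌋ 0 = 1 := by
      rw [bananaValue_of_le (by exact_mod_cast hK)]
      simp [p]
    simp only [State.value, start, camelValue_zero hB hK h0 h2, h1]
    simp
  have hend : 0 ≤ e.value B ⌊c⌋ (-1) := by
    simp only [State.value, hec, camelValue_zero hB hK he2.1 he2.2]
    exact add_nonneg (Finset.sum_nonneg fun i _ => (bananaValue_pos hB _ _).le) he2.1
  -- Only the `ε` term differs; `c - ⌊c⌋` lies in `[0, 1]`, where `p` is affine from `⌊c⌋`.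
  have hjump : s.value B ⌊c⌋ 1 = s.value B ⌊c⌋ (-1) + B * p B c := by
    have hle : (⌊c⌋ : ℝ) ≤ c + (B : ℝ) / 2 := by linarith
    have e1 := half_mul_p_int_add hB ⌊c⌋ (t := c - ⌊c⌋) (by linarith)
      (by linarith [Int.lt_floor_add_one c])
    rw [add_sub_cancel] at e1
    simp only [State.value, hsc, camelValue_of_ge hB hle hs2.1 hs2.2]
    linear_combination -2 * e1
  linarith

end Itinerary

end CamelBanana

theorem mainTheorem6 (B : ℕ) (hB : 1 ≤ B) (N : ℝ) (hN : (B : ℝ) ≤ N) (c : ℝ)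
    (hc : CamelBanana.CanPenetrateRoundTrip B N c) :
    c ≤ CamelBanana.pInv B (N / (B : ℝ)) + (B : ℝ) / 2 := by
  have hB0 : (0 : ℝ) < B := by exact_mod_cast hB
  rw [← sub_le_iff_le_add, ← (CamelBanana.p_strictMono B hB).le_iff_le,
    CamelBanana.p_pInv B hB (div_pos (hB0.trans_le hN) hB0)]
  rcases le_total 0 (c - (B : ℝ) / 2) with h | h
  · rw [le_div_iff₀' hB0]
    exact CamelBanana.mul_p_le_of_canPenetrateRoundTrip hB (hB0.le.trans hN) h
      (by rwa [sub_add_cancel])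
  -- Within `B/2` of the border the potential is not needed: `N ≥ B` suffices.
  · calc CamelBanana.p B (c - (B : ℝ) / 2) ≤ CamelBanana.p B 0 :=
          (CamelBanana.p_strictMono B hB).monotone h
      _ = 1 := by simp [CamelBanana.p]
      _ ≤ N / B := (one_le_div hB0).2 hN
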